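/- Let $\mathbb{F}$ be a finite-dimensional unital associative real algebra and let $V$ be a finitely generated free left $\mathbb{F}$-module. A vector $u\in V$ is called a \emph{good point} if, for some basis of $V$, its coordinates $u_1,\dots,u_n$ satisfy $\sum_i u_i\mathbb{F}=\mathbb{F}$; let $V^\bullet\subset V$ be the set of good points and let $\mathbb{P}(V):=V^\bullet/\mathbb{F}^\times$ be the projective space, a smooth manifold of dimension $\dim_{\mathbb{R}}V-\dim_{\mathbb{R}}\mathbb{F}$. (It carries the quotient topology; for an $\mathbb{F}$-linear functional $\ell:V\to\mathbb{F}$ and $p_0\in V$ with $\ell(p_0)=1$ there is the chart $[x]\mapsto \ell(x)^{-1}x-p_0\in\ker\ell$, defined on the set of $[x]$ with $\ell(x)\in\mathbb{F}^\times$.) Smooth functions on $\mathbb{P}(V)$ are regarded as $\mathbb{F}^\times$-invariant functions on $V^\bullet$. Let $\boldsymbol{p}\in\mathbb{P}(V)$, let $p\in V^\bullet$ be a representative of $\boldsymbol p$, and let $\mathrm{Lin}_{\mathbb F}$ denote the real vector space of $\mathbb{F}$-linear maps. (1) For every $\varphi\in \mathrm{Lin}_{\mathbb{F}}(\mathbb{F}p,V/\mathbb{F}p)$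 there is exactly one tangent vector $t_\varphi\in T_{\boldsymbol p}\mathbb{P}(V)$ such that $$t_\varphi(f)=\frac{d}{d\varepsilon}\Big|_{\varepsilon=0}f(q+\varepsilon v)$$ for every smooth function $f:\mathbb{P}(V)\to\mathbb{R}$, every representative $q$ of $\boldsymbol p$ and every representative $v\in V$ of $\varphi(q)\in V/\mathbb{F}p$; and the map $\varphi\mapsto t_\varphi$ is an $\mathbb{R}$-linear isomorphism $$\mathrm{Lin}_{\mathbb{F}}(\mathbb{F}p,V/\mathbb{F}p)\;\xrightarrow{\ \cong\ }\;T_{\boldsymbol p}\mathbb{P}(V).$$ (2) Suppose moreover that $\mathbb{F}$ is equipped with an involution $x\mapsto x^*$ (an $\mathbb{R}$-linear map with $1^*=1$, $(xy)^*=y^*x^*$ and $x^{**}=x$) whose only self-adjoint elements ($x^*=x$) are the real numbers, and that $V$ is equipped with a Hermitian form, i.e. a map $\langle\cdot,\cdot\rangle:V\times V\to\mathbb{F}$, additive and $\mathbb{F}$-linear in the first variable, with $\langle u,v\rangle^*=\langle v,u\rangle$ (possibly degenerate). If $\boldsymbol p$ is regular, i.e. $\langle p,p\rangle\neq 0$,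 and $p^\perp:=\{v\in V:\langle v,p\rangle=0\}$, then $\psi\mapsto t_{\pi\circ\psi}$, where $\pi:p^\perp\hookrightarrow V\to V/\mathbb{F}p$ is the natural map, is an $\mathbb{R}$-linear isomorphism $$\mathrm{Lin}_{\mathbb{F}}(\mathbb{F}p,p^\perp)\;\xrightarrow{\ \cong\ }\;T_{\boldsymbol p}\mathbb{P}(V).$$ -/

import Mathlib

open scoped Manifold ContDiff

noncomputable section

/-! ### Good points and the projective space of a free module -/

section Algebraic

variable (F V : Type*) [Ring F] [AddCommGroup V] [Module F V]

/-- `u` is a good point if, for some finite basis of `V`, the coordinates `u_i` of `u`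
satisfy `∑ i, u_i F = F`. -/
def IsGoodPoint {V : Type*} [AddCommGroup V] [Module F V] (u : V) : Prop :=
  ∃ (n : ℕ) (b : Module.Basis (Fin n) F V),
    ∀ y : F, ∃ c : Fin n → F, ∑ i, b.repr u i * c i = y

/-- The set `V^•` of good points. -/
abbrev GoodPoints : Type _ := {u : V // IsGoodPoint F u}

/-- Two good points are equivalent when they lie in the same orbit of the unit group. -/
def projSetoid : Setoid (GoodPoints F V) :=
  (MulAction.orbitRel Fˣ V).comap Subtype.val

/-- The projective space `P(V) = V^• / Fˣ`. -/
def ProjSpace : Type _ := Quotient (projSetoid F V)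

variable {F V}

/-- The point of `P(V)` with representative `p`. -/
def ProjSpace.mk (p : GoodPoints F V) : ProjSpace F V := Quotient.mk (projSetoid F V) p

theorem ProjSpace.mk_eq_mk {p q : GoodPoints F V} :
    ProjSpace.mk p = ProjSpace.mk q ↔ ∃ u : Fˣ, u • (q : V) = p := by
  exact Quotient.eq (r := projSetoid F V)

theorem IsGoodPoint.exists_functional {x : V} (hx : IsGoodPoint F x) :
    ∃ l : V →ₗ[F] F, l x = 1 := by
  obtain ⟨n, b, hb⟩ := hx
  obtain ⟨c, hc⟩ := hb 1
  refine ⟨∑ i, (LinearMap.toSpanSingleton F F (c i)).comp (b.coord i), ?_⟩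
  simpa using hc

theorem isGoodPoint_of_functional [Module.Free F V] [Module.Finite F V] {x : V}
    (l : V →ₗ[F] F) (hl : IsUnit (l x)) : IsGoodPoint F x := by
  let b := (Module.Free.chooseBasis F V).reindex
    (Fintype.equivFin (Module.Free.ChooseBasisIndex F V))
  refine ⟨_, b, fun y => ⟨fun i => l (b i) * (↑(hl.unit⁻¹) * y), ?_⟩⟩
  have h : ∑ i, b.repr x i * l (b i) = l x := by
    conv_rhs => rw [← b.sum_repr x, map_sum]
    simp
  calc ∑ i, b.repr x i * (l (b i) * (↑(hl.unit⁻¹) * y))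
      = (∑ i, b.repr x i * l (b i)) * (↑(hl.unit⁻¹) * y) := by
        rw [Finset.sum_mul]; simp only [mul_assoc]
    _ = y := by rw [h, ← mul_assoc, IsUnit.mul_val_inv, one_mul]

open Classical in
/-- A function `f` on `P(V)`, seen as an invariant function on `V^•`
(and extended by `0` to the rest of `V`). -/
def ProjSpace.pull (f : ProjSpace F V → ℝ) (x : V) : ℝ :=
  if hx : IsGoodPoint F x then f (ProjSpace.mk ⟨x, hx⟩) else 0

end Algebraic

/-! ### The smooth structure of the projective space

The chart around `[p]` attached to a linear functional `l` with `l p = 1` is the affine chart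
`[x] ↦ (l x)⁻¹ x - p`, defined where `l x` is a unit, with values in `ker l`; the kernel is
identified with a Euclidean space by a real linear isomorphism. -/

section Smooth

set_option linter.unusedSectionVars false

instance {F V : Type*} [Ring F] [AddCommGroup V] [Module F V] [TopologicalSpace V] :
    TopologicalSpace (ProjSpace F V) :=
  inferInstanceAs (TopologicalSpace (Quotient (projSetoid F V)))

theorem ProjSpace.isQuotientMap_mk {F V : Type*} [Ring F] [AddCommGroup V] [Module F V]
    [TopologicalSpace V] :
    Topology.IsQuotientMap (ProjSpace.mk : GoodPoints F V → ProjSpace F V) :=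
  isQuotientMap_quotient_mk'

variable (F V : Type*) [Ring F] [Algebra ℝ F] [Module.Finite ℝ F]
  [NormedAddCommGroup V] [NormedSpace ℝ V] [Module F V] [IsScalarTower ℝ F V]

/-- The model space of `P(V)`, of real dimension `dim V - dim F`. -/
abbrev ProjModel : Type :=
  EuclideanSpace ℝ (Fin (Module.finrank ℝ V - Module.finrank ℝ F))

variable {F V}

theorem smooth_normalize [Module.Finite F V] (l : V →ₗ[F] F) :
    IsOpen {x : V | IsUnit (l x)} ∧
      ContDiffOn ℝ ∞ (fun x : V => Ring.inverse (l x) • x) {x : V | IsUnit (l x)} := by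
  have : Module.Finite ℝ V := Module.Finite.trans F V
  let b := Module.finBasis ℝ F
  let _ : NormedRing (Matrix (Fin (Module.finrank ℝ F)) (Fin (Module.finrank ℝ F)) ℝ) :=
    Matrix.linftyOpNormedRing
  let _ : NormedAlgebra ℝ (Matrix (Fin (Module.finrank ℝ F)) (Fin (Module.finrank ℝ F)) ℝ) :=
    Matrix.linftyOpNormedAlgebra
  let _ : NormedRing F := NormedRing.induced F _ (Algebra.leftMulMatrix b)
    (Algebra.leftMulMatrix_injective b)
  let _ : NormedAlgebra ℝ F := NormedAlgebra.induced ℝ F _ (Algebra.leftMulMatrix b)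
  have : CompleteSpace F := FiniteDimensional.complete ℝ F
  let lr : V →L[ℝ] F := LinearMap.toContinuousLinearMap (l.restrictScalars ℝ)
  let A : F →L[ℝ] (V →L[ℝ] V) := LinearMap.toContinuousLinearMap
    ((LinearMap.toContinuousLinearMap : (V →ₗ[ℝ] V) ≃ₗ[ℝ] (V →L[ℝ] V)).toLinearMap ∘ₗ
      (Algebra.lsmul ℝ ℝ V : F →ₐ[ℝ] Module.End ℝ V).toLinearMap)
  have hlr : ∀ x, lr x = l x := fun x => rfl
  refine ⟨Units.isOpen.preimage lr.continuous, fun x hx => ContDiffAt.contDiffWithinAt ?_⟩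
  have h1 : ContDiffAt ℝ ∞ (fun x : V => Ring.inverse (l x)) x := by
    obtain ⟨u, hu⟩ := hx
    have h2 : ContDiffAt ℝ ∞ Ring.inverse (lr x) := by
      rw [hlr, ← hu]
      exact contDiffAt_ringInverse ℝ u
    exact h2.comp x lr.contDiff.contDiffAt
  have h3 : ContDiffAt ℝ ∞ (fun x : V => A (Ring.inverse (l x))) x :=
    A.contDiff.contDiffAt.comp x h1
  exact h3.clm_apply contDiffAt_id

/-- The kernel of a functional, as a real vector space. -/
abbrev kerReal (l : V →ₗ[F] F) : Submodule ℝ V := LinearMap.ker (l.restrictScalars ℝ)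

/-- The projection `x ↦ x - (l x) p` onto the kernel of `l`, where `l p = 1`. -/
def kerProj (l : V →ₗ[F] F) (p : V) (h : l p = 1) : V →ₗ[ℝ] kerReal l :=
  LinearMap.codRestrict (kerReal l)
    (LinearMap.id - (LinearMap.toSpanSingleton F V p ∘ₗ l).restrictScalars ℝ)
    (fun x => by simp [h])

theorem kerProj_coe (l : V →ₗ[F] F) (p : V) (h : l p = 1) (x : V) :
    (kerProj l p h x : V) = x - l x • p := rfl

theorem finrank_kerReal [Module.Finite F V] (l : V →ₗ[F] F) (p : V) (h : l p = 1) :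
    Module.finrank ℝ (kerReal l) =
      Module.finrank ℝ (ProjModel F V) := by
  have : Module.Finite ℝ V := Module.Finite.trans F V
  have h1 := LinearMap.finrank_range_add_finrank_ker (l.restrictScalars ℝ)
  have h2 : LinearMap.range (l.restrictScalars ℝ) = ⊤ := by
    rw [LinearMap.range_eq_top]
    exact fun a => ⟨a • p, by simp [h]⟩
  rw [h2, finrank_top] at h1
  rw [finrank_euclideanSpace_fin]
  exact Nat.eq_sub_of_add_eq' h1

/-- An identification of the kernel of `l` with the model space. -/
def kerEquiv [Module.Finite F V] (l : V →ₗ[F] F) (p : V) (h : l p = 1) :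
    kerReal l ≃L[ℝ] ProjModel F V :=
  haveI : Module.Finite ℝ V := Module.Finite.trans F V
  ContinuousLinearEquiv.ofFinrankEq (finrank_kerReal l p h)

/-- The affine coordinate `x ↦ (l x)⁻¹ x - p` of a vector `x` for which `l x` is a unit. -/
def affineCoord [Module.Finite F V] (l : V →ₗ[F] F) (p : V) (h : l p = 1) (x : V) :
    ProjModel F V :=
  kerEquiv l p h (kerProj l p h (Ring.inverse (l x) • x))

theorem contDiffOn_affineCoord [Module.Finite F V] (l : V →ₗ[F] F) (p : V) (h : l p = 1) :
    ContDiffOn ℝ ∞ (affineCoord l p h) {x : V | IsUnit (l x)} := by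
  have : Module.Finite ℝ V := Module.Finite.trans F V
  exact (kerEquiv l p h).contDiff.comp_contDiffOn
    ((LinearMap.toContinuousLinearMap (kerProj l p h)).contDiff.comp_contDiffOn
      (smooth_normalize l).2)

theorem affineCoord_smul [Module.Finite F V] (l : V →ₗ[F] F) (p : V) (h : l p = 1)
    (u : Fˣ) (x : V) : affineCoord l p h (u • x) = affineCoord l p h x := by
  have : Ring.inverse (l (u • x)) • (u • x) = Ring.inverse (l x) • x := by
    have h1 : l (u • x) = u * l x := by rw [Units.smul_def, map_smul, smul_eq_mul]
    rw [h1]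
    by_cases hx : IsUnit (l x)
    · obtain ⟨w, hw⟩ := hx
      rw [← hw, ← Units.val_mul, Ring.inverse_unit, Ring.inverse_unit, Units.smul_def, smul_smul,
        ← Units.val_mul, mul_inv_rev, inv_mul_cancel_right]
    · rw [Ring.inverse_non_unit _ hx, Ring.inverse_non_unit, zero_smul, zero_smul]
      rwa [Units.isUnit_units_mul]
  rw [affineCoord, this, affineCoord]

variable [Module.Free F V] [Module.Finite F V]

/-- The affine coordinate as a function on `P(V)`. -/
def ProjSpace.coord (l : V →ₗ[F] F) (p : V) (h : l p = 1) : ProjSpace F V → ProjModel F V :=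
  Quotient.lift (fun x : GoodPoints F V => affineCoord l p h x) (fun x y hxy => by
    obtain ⟨u, hu⟩ := hxy
    have hu' : u • (y : V) = x := hu
    rw [← hu', affineCoord_smul])

/-- The domain of the affine coordinate: the points `[x]` for which `l x` is a unit. -/
def ProjSpace.domain (l : V →ₗ[F] F) : Set (ProjSpace F V) :=
  {P | ∃ x : GoodPoints F V, ProjSpace.mk x = P ∧ IsUnit (l x)}

theorem ProjSpace.mk_mem_domain (l : V →ₗ[F] F) (x : GoodPoints F V) :
    ProjSpace.mk x ∈ ProjSpace.domain l ↔ IsUnit (l x) := by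
  constructor
  · rintro ⟨y, hy, hu⟩
    obtain ⟨u, hu'⟩ := ProjSpace.mk_eq_mk.1 hy
    rw [← hu', Units.smul_def, map_smul, smul_eq_mul, Units.isUnit_units_mul] at hu
    exact hu
  · exact fun hx => ⟨x, rfl, hx⟩

theorem ProjSpace.isOpen_domain (l : V →ₗ[F] F) : IsOpen (ProjSpace.domain l) := by
  rw [← ProjSpace.isQuotientMap_mk.isOpen_preimage]
  convert (smooth_normalize l).1.preimage
    (continuous_subtype_val : Continuous (Subtype.val : GoodPoints F V → V)) using 1
  ext x
  exact ProjSpace.mk_mem_domain l x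

/-- The affine chart of `P(V)` attached to `p` and a functional `l` with `l p = 1`. -/
def affineChart (l : V →ₗ[F] F) (p : V) (h : l p = 1) :
    OpenPartialHomeomorph (ProjSpace F V) (ProjModel F V) where
  toFun := ProjSpace.coord l p h
  invFun y := ProjSpace.mk ⟨p + ((kerEquiv l p h).symm y : V),
    isGoodPoint_of_functional l (by
      have : l ((kerEquiv l p h).symm y : V) = 0 := ((kerEquiv l p h).symm y).2
      rw [map_add, this, h, add_zero]
      exact isUnit_one)⟩
  source := ProjSpace.domain l
  target := Set.univ
  map_source' _ _ := Set.mem_univ _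
  map_target' y _ := ⟨_, rfl, by
    have : l ((kerEquiv l p h).symm y : V) = 0 := ((kerEquiv l p h).symm y).2
    simp only [map_add, this, h, add_zero]
    exact isUnit_one⟩
  left_inv' := by
    rintro _ ⟨x, rfl, w, hw⟩
    rw [ProjSpace.mk_eq_mk]
    refine ⟨w⁻¹, ?_⟩
    change w⁻¹ • (x : V) = p + ((kerEquiv l p h).symm (affineCoord l p h x) : V)
    rw [affineCoord, ContinuousLinearEquiv.symm_apply_apply, kerProj_coe, map_smul, ← hw,
      Ring.inverse_unit, smul_eq_mul, Units.inv_mul, one_smul, Units.smul_def]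
    abel
  right_inv' := by
    intro y _
    have h0 : l ((kerEquiv l p h).symm y : V) = 0 := ((kerEquiv l p h).symm y).2
    have h1 : l (p + ((kerEquiv l p h).symm y : V)) = 1 := by rw [map_add, h0, h, add_zero]
    change affineCoord l p h (p + ((kerEquiv l p h).symm y : V)) = y
    rw [affineCoord, h1, Ring.inverse_one, one_smul, ← ContinuousLinearEquiv.eq_symm_apply]
    apply Subtype.ext
    rw [kerProj_coe, h1, one_smul, add_sub_cancel_left]
  open_source := ProjSpace.isOpen_domain l
  open_target := isOpen_univ
  continuousOn_toFun := by
    rw [ProjSpace.isQuotientMap_mk.continuousOn_isOpen_iff (ProjSpace.isOpen_domain l)]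
    exact (contDiffOn_affineCoord l p h).continuousOn.comp
      continuous_subtype_val.continuousOn (fun x hx => (ProjSpace.mk_mem_domain l x).1 hx)
  continuousOn_invFun := by
    refine (ProjSpace.isQuotientMap_mk.continuous.comp ?_).continuousOn
    exact Continuous.subtype_mk (continuous_const.add
      (continuous_subtype_val.comp (kerEquiv l p h).symm.continuous)) _

theorem ProjSpace.exists_chart (P : ProjSpace F V) :
    ∃ d : (V →ₗ[F] F) × V, ∃ h : d.1 d.2 = 1, P ∈ (affineChart d.1 d.2 h).source := by
  obtain ⟨x, rfl⟩ := ProjSpace.isQuotientMap_mk.surjective P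
  obtain ⟨l, hl⟩ := x.2.exists_functional
  exact ⟨(l, x), hl, x, rfl, by rw [hl]; exact isUnit_one⟩

/-- The atlas consists of all affine charts. -/
instance : ChartedSpace (ProjModel F V) (ProjSpace F V) where
  atlas := {e | ∃ (l : V →ₗ[F] F) (p : V) (h : l p = 1), e = affineChart l p h}
  chartAt P := affineChart (ProjSpace.exists_chart P).choose.1 (ProjSpace.exists_chart P).choose.2
    (ProjSpace.exists_chart P).choose_spec.choose
  mem_chart_source P := (ProjSpace.exists_chart P).choose_spec.choose_spec
  chart_mem_atlas _ := ⟨_, _, _, rfl⟩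

/-- The projective space is a smooth manifold. -/
instance : IsManifold 𝓘(ℝ, ProjModel F V) ∞ (ProjSpace F V) := by
  apply isManifold_of_contDiffOn
  rintro _ _ ⟨l, p, h, rfl⟩ ⟨l', p', h', rfl⟩
  have : Module.Finite ℝ V := Module.Finite.trans F V
  have h1 : ContDiff ℝ ∞ (fun y : ProjModel F V => p + ((kerEquiv l p h).symm y : V)) :=
    contDiff_const.add ((kerReal l).subtypeL.contDiff.comp (kerEquiv l p h).symm.contDiff)
  refine ((contDiffOn_affineCoord l' p' h').comp h1.contDiffOn ?_)
  rintro y ⟨⟨_, hy⟩, _⟩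
  exact (ProjSpace.mk_mem_domain l' _).1 hy

/-- The tangent space of `P(V)` at `P`. -/
abbrev ProjTangent (P : ProjSpace F V) : Type := TangentSpace 𝓘(ℝ, ProjModel F V) P

/-- The tangent vector `ξ` at `P` acts on smooth functions `f` on `P(V)` by
`ξ(f) = d/dε f(x + ε v)` at `ε = 0`. -/
def ActsAsDirectionalDerivative (P : ProjSpace F V) (ξ : ProjTangent P) (x v : V) : Prop :=
  ∀ f : C^∞⟮𝓘(ℝ, ProjModel F V), ProjSpace F V; 𝓘(ℝ, ℝ), ℝ⟯,
    HasDerivAt (fun ε : ℝ => ProjSpace.pull f (x + ε • v))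
      (mfderiv 𝓘(ℝ, ProjModel F V) 𝓘(ℝ, ℝ) f P ξ) 0

end Smooth

/-! ### Hermitian forms -/

/-- An `F`-valued Hermitian form on a left module over a ring `F` with involution. -/
structure HermitianFormOn (F V : Type*) [Ring F] [StarRing F] [AddCommGroup V] [Module F V] where
  /-- The underlying pairing. -/
  toFun : V → V → F
  add_left : ∀ u v w, toFun (u + v) w = toFun u w + toFun v w
  smul_left : ∀ (z : F) (u v : V), toFun (z • u) v = z * toFun u v
  star_symm : ∀ u v, star (toFun u v) = toFun v u

/-- The orthogonal complement `p^⊥ = {v | ⟨v, p⟩ = 0}`. -/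
def HermitianFormOn.perp {F V : Type*} [Ring F] [StarRing F] [AddCommGroup V] [Module F V]
    (h : HermitianFormOn F V) (p : V) : Submodule F V where
  carrier := {v | h.toFun v p = 0}
  add_mem' {a b} ha hb := by
    have ha' : h.toFun a p = 0 := ha
    have hb' : h.toFun b p = 0 := hb
    change h.toFun (a + b) p = 0
    rw [h.add_left, ha', hb', add_zero]
  zero_mem' := by
    change h.toFun 0 p = 0
    simpa using h.smul_left 0 0 p
  smul_mem' z v hv := by
    have hv' : h.toFun v p = 0 := hv
    change h.toFun (z • v) p = 0
    rw [h.smul_left, hv', mul_zero]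

end

/-! ### Common affine charts and the Hausdorff property -/

noncomputable section

/-! The chart chosen at `[p]` is affine, given by a functional `l`; rescale `p` to a representative
`x` with `l x = 1`. Normalizing the line `x + ε w` by `l` gives a curve with velocity `w - l(w) x`
in `ker l` (`hasDerivAt_normalize`), so in this chart "derivative along `w` at `x`" is that vector.
It depends only on `w` modulo `F p`, and `ker l` is a complement of `F p`; evaluation at `x`
therefore identifies `Lin(F p, V/F p)` with `V/F p`, with `ker l`, and with the tangent space.
Invariance under units transfers the formula from `x` to every representative.

Uniqueness of the tangent vector needs enough global smooth functions. These come from bump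
functions, which require `P(V)` to be Hausdorff; this holds because any two points lie in a common
affine chart (`ProjSpace.exists_affineChart_source`).

For the Hermitian part, `⟨p,p⟩` is a nonzero real, hence a unit, so `p^⊥` is another complement of
`F p`. -/

theorem spectrum_finite_of_finite_algebra {F : Type*} [Ring F] [Algebra ℝ F] [Module.Finite ℝ F]
    (a : F) : (spectrum ℝ a).Finite := by
  have hm : minpoly ℝ a ≠ 0 := minpoly.ne_zero (Algebra.IsIntegral.isIntegral a)
  refine ((minpoly ℝ a).roots.toFinset.finite_toSet).subset fun k hk => ?_
  -- Spectral mapping: `minpoly(k)` lies in the spectrum of `minpoly(a) = 0`, so it cannot be a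
  -- unit.
  have h := spectrum.subset_polynomial_aeval a (minpoly ℝ a) ⟨k, hk, rfl⟩
  rw [minpoly.aeval, spectrum.mem_iff, sub_zero] at h
  simp only [Finset.mem_coe, Multiset.mem_toFinset]
  rw [Polynomial.mem_roots hm, Polynomial.IsRoot.def]
  by_contra h0
  exact h ((isUnit_iff_ne_zero.2 h0).map (algebraMap ℝ F))

section

set_option linter.unusedSectionVars false

variable {F V : Type*} [Ring F] [Algebra ℝ F] [Module.Finite ℝ F]
  [NormedAddCommGroup V] [NormedSpace ℝ V] [Module F V] [IsScalarTower ℝ F V]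

theorem isUnit_add_algebraMap {a : F} {r : ℝ} (h : -r ∉ spectrum ℝ a) :
    IsUnit (a + algebraMap ℝ F r) := by
  rw [spectrum.notMem_iff] at h
  convert h.neg using 1
  rw [map_neg]
  abel

/-- Two vectors on which some functionals take the value `1` admit a common functional that takes
unit values on both. -/
theorem exists_functional_isUnit_isUnit {x y : V} {l l' : V →ₗ[F] F} (hl : l x = 1)
    (hl' : l' y = 1) : ∃ k : V →ₗ[F] F, IsUnit (k x) ∧ IsUnit (k y) := by
  -- The functional is `l' + l·r` for a real `r` outside a finite bad set. Its values are `l' x + r`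
  -- at `x` and `1 + r (l y) = r (l y + r⁻¹)` at `y`, whence the two spectral conditions and `r ≠
  -- 0`.
  have hfin : ({0} ∪ Neg.neg ⁻¹' spectrum ℝ (l' x) ∪
      (fun r : ℝ => -r⁻¹) ⁻¹' spectrum ℝ (l y)).Finite := by
    refine ((Set.finite_singleton 0).union ?_).union ?_
    · exact (spectrum_finite_of_finite_algebra _).preimage neg_injective.injOn
    · exact (spectrum_finite_of_finite_algebra _).preimage
        (neg_injective.comp inv_injective).injOn
  obtain ⟨r, hr⟩ := hfin.exists_notMem
  simp only [Set.mem_union, Set.mem_singleton_iff, Set.mem_preimage, not_or] at hr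
  obtain ⟨⟨h0, h1⟩, h2⟩ := hr
  refine ⟨l' + (LinearMap.toSpanSingleton F F (algebraMap ℝ F r)) ∘ₗ l, ?_, ?_⟩
  · simpa [hl] using isUnit_add_algebraMap h1
  · have h3 := ((isUnit_iff_ne_zero.2 h0).map (algebraMap ℝ F)).mul (isUnit_add_algebraMap h2)
    rw [mul_add, ← map_mul, mul_inv_cancel₀ h0, map_one, Algebra.commutes r (l y)] at h3
    simpa [hl', add_comm] using h3

variable [Module.Free F V] [Module.Finite F V]

theorem ProjSpace.exists_affineChart_source (P Q : ProjSpace F V) :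
    ∃ (l : V →ₗ[F] F) (p : V) (h : l p = 1),
      P ∈ (affineChart l p h).source ∧ Q ∈ (affineChart l p h).source := by
  obtain ⟨x, rfl⟩ := ProjSpace.isQuotientMap_mk.surjective P
  obtain ⟨y, rfl⟩ := ProjSpace.isQuotientMap_mk.surjective Q
  obtain ⟨l, hl⟩ := x.2.exists_functional
  obtain ⟨l', hl'⟩ := y.2.exists_functional
  obtain ⟨k, ⟨u, hu⟩, hy⟩ := exists_functional_isUnit_isUnit hl hl'
  refine ⟨k, (↑u⁻¹ : F) • (x : V), by rw [map_smul, ← hu, smul_eq_mul, Units.inv_mul], ?_, ?_⟩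
  · exact (ProjSpace.mk_mem_domain k x).2 ⟨u, hu⟩
  · exact (ProjSpace.mk_mem_domain k y).2 hy

/-- Two points in one chart domain are separated by pulling back disjoint open sets of the Euclidean
model. -/
instance ProjSpace.instT2Space : T2Space (ProjSpace F V) := by
  refine ⟨fun P Q hPQ => ?_⟩
  obtain ⟨l, p, h, hP, hQ⟩ := ProjSpace.exists_affineChart_source P Q
  set e := affineChart l p h
  obtain ⟨A, B, hA, hB, hPA, hQB, hd⟩ :=
    t2_separation (fun H => hPQ (e.injOn hP hQ H) : e P ≠ e Q)
  refine ⟨e.source ∩ e ⁻¹' A, e.source ∩ e ⁻¹' B, e.isOpen_inter_preimage hA,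
    e.isOpen_inter_preimage hB, ⟨hP, hPA⟩, ⟨hQ, hQB⟩, ?_⟩
  rw [Set.disjoint_left] at hd ⊢
  exact fun z hz hz' => hd hz.2 hz'.2

/-! ### Tangent vectors as derivations -/

/-- The differential of a function at `P`, as a functional on the model space. -/
def ProjSpace.differential (f : ProjSpace F V → ℝ) (P : ProjSpace F V) : ProjModel F V →L[ℝ] ℝ :=
  mfderiv 𝓘(ℝ, ProjModel F V) 𝓘(ℝ, ℝ) f P

/-- In a chart at `P`, the differential of a smooth function is the derivative of its coordinate
expression. -/
theorem ProjSpace.hasFDerivAt_chart (P : ProjSpace F V) {f : ProjSpace F V → ℝ}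
    (hf : MDifferentiableAt 𝓘(ℝ, ProjModel F V) 𝓘(ℝ, ℝ) f P) :
    HasFDerivAt (f ∘ (chartAt (ProjModel F V) P).symm)
      (ProjSpace.differential f P)
      (chartAt (ProjModel F V) P P) := by
  have h : HasFDerivWithinAt (f ∘ (chartAt (ProjModel F V) P).symm)
      (ProjSpace.differential f P) (Set.range id) (chartAt (ProjModel F V) P P) :=
    hf.hasMFDerivAt.2
  rwa [Set.range_id, hasFDerivWithinAt_univ] at h

/-- A tangent vector is determined by its action on smooth functions. -/
theorem ProjTangent.ext_mfderiv {P : ProjSpace F V} {ξ η : ProjTangent P}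
    (h : ∀ f : C^∞⟮𝓘(ℝ, ProjModel F V), ProjSpace F V; 𝓘(ℝ, ℝ), ℝ⟯,
      mfderiv 𝓘(ℝ, ProjModel F V) 𝓘(ℝ, ℝ) f P ξ = mfderiv 𝓘(ℝ, ProjModel F V) 𝓘(ℝ, ℝ) f P η) :
    ξ = η := by
  let e := chartAt (ProjModel F V) P
  -- Pairing with `ξ - η` itself: once `L ξ = L η` is known, `‖ξ - η‖² = 0`.
  let L : ProjModel F V →L[ℝ] ℝ := innerSL ℝ (show ProjModel F V from ξ - η)
  obtain ⟨b⟩ : Nonempty (SmoothBumpFunction 𝓘(ℝ, ProjModel F V) P) := inferInstance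
  -- Cutting off by `b` makes the coordinate function global; this is where the Hausdorff property
  -- enters. Since `b = 1` near `P`, the differential there is still `L`.
  have hs : ContMDiff 𝓘(ℝ, ProjModel F V) 𝓘(ℝ, ℝ) ∞ (fun z => b z • L (e z)) := by
    refine b.contMDiff_smul ?_
    exact L.contDiff.contMDiff.comp_contMDiffOn (contMDiffOn_chart (x := P))
  have h1 := (ProjSpace.hasFDerivAt_chart P
    (hs.mdifferentiableAt (by simp) : MDifferentiableAt _ _ _ P))
  have h2 : ((fun z => b z • L (e z)) ∘ e.symm) =ᶠ[nhds (e P)] L := by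
    have ht : ∀ᶠ y in nhds (e P), y ∈ e.target :=
      e.open_target.mem_nhds (e.map_source (mem_chart_source _ P))
    have hb : ∀ᶠ y in nhds (e P), b (e.symm y) = (1 : ProjSpace F V → ℝ) (e.symm y) := by
      have ht' := e.continuousAt_symm (e.map_source (mem_chart_source _ P))
      rw [ContinuousAt, e.left_inv (mem_chart_source _ P)] at ht'
      exact ht'.eventually b.eventuallyEq_one
    filter_upwards [ht, hb] with y hy hby
    simp only [Function.comp_apply, hby, Pi.one_apply, one_smul, e.right_inv hy]
  have h2' : HasFDerivAt ((fun z => b z • L (e z)) ∘ e.symm) L (e P) :=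
    HasFDerivAt.congr_of_eventuallyEq L.hasFDerivAt h2
  have h3 := HasFDerivAt.unique h1 h2'
  have h4 := h ⟨_, hs⟩
  have h5 : L (show ProjModel F V from ξ) = L (show ProjModel F V from η) := by
    rw [← h3]; exact h4
  have h6 : L (show ProjModel F V from ξ - η) = 0 := by
    change L ((show ProjModel F V from ξ) - (show ProjModel F V from η)) = 0
    rw [map_sub, h5, sub_self]
  rw [innerSL_apply_apply, inner_self_eq_zero] at h6
  exact sub_eq_zero.1 h6

/-! ### Directional derivatives in affine coordinates -/

theorem smulLinearMap_hasDerivAt (a : F) {γ : ℝ → V} {z : V} {s : ℝ} (hγ : HasDerivAt γ z s) :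
    HasDerivAt (fun ε => a • γ ε) (a • z) s := by
  have : Module.Finite ℝ V := Module.Finite.trans F V
  let A : V →L[ℝ] V := LinearMap.toContinuousLinearMap (Algebra.lsmul ℝ ℝ V a)
  exact A.hasFDerivAt.comp_hasDerivAt s hγ

/-- The derivative of the normalization `x ↦ (l x)⁻¹ x` at a normalized point. -/
theorem hasDerivAt_normalize (l : V →ₗ[F] F) {x : V} (hx : l x = 1) (w : V) :
    HasDerivAt (fun ε : ℝ => Ring.inverse (l (x + ε • w)) • (x + ε • w)) (w - l w • x) 0 := by
  have hline : HasDerivAt (fun ε : ℝ => x + ε • w) w 0 := by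
    simpa using ((hasDerivAt_id (0 : ℝ)).smul_const w).const_add x
  have hU := (smooth_normalize l).1
  have hx0 : x + (0 : ℝ) • w ∈ {x : V | IsUnit (l x)} := by simp [hx]
  have hN : DifferentiableAt ℝ (fun x : V => Ring.inverse (l x) • x) (x + (0 : ℝ) • w) :=
    ((smooth_normalize l).2.contDiffAt (hU.mem_nhds hx0)).differentiableAt (by simp)
  have hγ := hN.hasFDerivAt.comp_hasDerivAt (0 : ℝ) hline
  set γ : ℝ → V := (fun x : V => Ring.inverse (l x) • x) ∘ fun ε : ℝ => x + ε • w with hγdef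
  set z := fderiv ℝ (fun x : V => Ring.inverse (l x) • x) (x + (0 : ℝ) • w) w
  have hγ0 : γ 0 = x := by simp [hγdef, hx]
  -- The inverse is never differentiated explicitly: `γ` has some derivative `z`, and
  -- differentiating `(1 + ε l(w)) γ(ε) = x + ε w` at `0` forces `z + l(w) x = w`.
  have hsum : HasDerivAt (fun ε : ℝ => γ ε + ε • (l w • γ ε)) (z + l w • x) 0 := by
    have := hγ.add ((hasDerivAt_id (0 : ℝ)).smul (smulLinearMap_hasDerivAt (l w) hγ))
    simp only [id_eq, zero_smul, one_smul, zero_add, hγ0] at this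
    exact this
  have heq : (fun ε : ℝ => γ ε + ε • (l w • γ ε)) =ᶠ[nhds 0] fun ε : ℝ => x + ε • w := by
    filter_upwards [hline.continuousAt.eventually (hU.mem_nhds hx0)] with ε hε
    have h1 : l (x + ε • w) • γ ε = x + ε • w := by
      simp only [hγdef, Function.comp_apply]
      rw [smul_smul, Ring.mul_inverse_cancel _ hε, one_smul]
    have h2 : l (x + ε • w) = 1 + ε • l w := by
      rw [map_add, hx]; congr 1; exact (l.restrictScalars ℝ).map_smul ε w
    rw [← h1, h2, add_smul, one_smul, smul_assoc]
  have hz : z + l w • x = w := (hsum.congr_of_eventuallyEq heq.symm).unique hline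
  rw [← eq_sub_iff_add_eq.2 hz]
  exact hγ

/-- The chart's base point `p` need not be `x`. This is harmless: `w - l(w) x` already lies in `ker
l`, so projecting along `p` fixes it. -/
theorem hasDerivAt_affineCoord (l : V →ₗ[F] F) (p : V) (h : l p = 1) {x : V} (hx : l x = 1)
    (w : V) :
    HasDerivAt (fun ε : ℝ => affineCoord l p h (x + ε • w))
      (kerEquiv l p h (kerProj l x hx w)) 0 := by
  have : Module.Finite ℝ V := Module.Finite.trans F V
  let A : V →L[ℝ] ProjModel F V := (kerEquiv l p h : kerReal l →L[ℝ] ProjModel F V) ∘L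
    LinearMap.toContinuousLinearMap (kerProj l p h)
  have h1 := A.hasFDerivAt.comp_hasDerivAt (0 : ℝ) (hasDerivAt_normalize l hx w)
  have h2 : A (w - l w • x) = kerEquiv l p h (kerProj l x hx w) := by
    change kerEquiv l p h (kerProj l p h (w - l w • x)) = _
    congr 1
    apply Subtype.ext
    rw [kerProj_coe, kerProj_coe, map_sub, map_smul, hx]
    simp
  rw [← h2]
  exact h1

theorem ProjSpace.pull_smul {f : ProjSpace F V → ℝ} (u : Fˣ) (x : V) :
    ProjSpace.pull f (u • x) = ProjSpace.pull f x := by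
  have good : ∀ (u : Fˣ) (x : V), IsGoodPoint F x → IsGoodPoint F (u • x) := fun u x hx => by
    obtain ⟨l, hl⟩ := hx.exists_functional
    refine isGoodPoint_of_functional l ?_
    rw [Units.smul_def, map_smul, hl, smul_eq_mul, mul_one]
    exact u.isUnit
  by_cases hx : IsGoodPoint F x
  · rw [ProjSpace.pull, ProjSpace.pull, dif_pos hx, dif_pos (good u x hx)]
    exact congrArg f (ProjSpace.mk_eq_mk.2 ⟨u, rfl⟩)
  -- Off the good points both sides take the default value `0`.
  · have hx' : ¬ IsGoodPoint F (u • x) := fun H => hx (by simpa using good u⁻¹ _ H)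
    rw [ProjSpace.pull, ProjSpace.pull, dif_neg hx, dif_neg hx']

theorem ProjSpace.pull_eq_chart (l : V →ₗ[F] F) (p : V) (h : l p = 1) (f : ProjSpace F V → ℝ)
    {x : V} (hx : IsUnit (l x)) :
    ProjSpace.pull f x = f ((affineChart l p h).symm (affineCoord l p h x)) := by
  have hg := isGoodPoint_of_functional l hx
  rw [ProjSpace.pull, dif_pos hg]
  exact congrArg f ((affineChart l p h).left_inv
    ((ProjSpace.mk_mem_domain l ⟨x, hg⟩).2 hx)).symm

/-- In the affine chart at `P`, the vector `w - (l w) x` acts as the derivative in the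
direction `w` at a normalized representative `x` of `P`. -/
theorem actsAsDirectionalDerivative_kerProj {P : ProjSpace F V} {l : V →ₗ[F] F} {p : V}
    {h : l p = 1} (hc : chartAt (ProjModel F V) P = affineChart l p h) (x : GoodPoints F V)
    (hP : ProjSpace.mk x = P) (hx : l x = 1) (w : V) :
    ActsAsDirectionalDerivative P (kerEquiv l p h (kerProj l x hx w)) x w := by
  intro f
  have h1 := ProjSpace.hasFDerivAt_chart P (f.contMDiff.mdifferentiableAt (by simp))
  rw [hc] at h1
  have h0 : affineChart l p h P = affineCoord l p h (x + (0 : ℝ) • w) := by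
    rw [← hP, zero_smul, add_zero]; rfl
  rw [h0] at h1
  have h2 := h1.comp_hasDerivAt (0 : ℝ) (hasDerivAt_affineCoord l p h hx w)
  refine h2.congr_of_eventuallyEq ?_
  have hcont : ContinuousAt (fun ε : ℝ => (x : V) + ε • w) 0 := by fun_prop
  have hx0 : (x : V) + (0 : ℝ) • w ∈ {x : V | IsUnit (l x)} := by simp [hx]
  filter_upwards [hcont.eventually ((smooth_normalize l).1.mem_nhds hx0)] with ε hε
  exact ProjSpace.pull_eq_chart l p h f hε

theorem ActsAsDirectionalDerivative.smul {P : ProjSpace F V} {ξ : ProjTangent P} {x v : V}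
    (h : ActsAsDirectionalDerivative P ξ x v) (u : Fˣ) :
    ActsAsDirectionalDerivative P ξ (u • x) (u • v) := by
  intro f
  refine (h f).congr_of_eventuallyEq (Filter.Eventually.of_forall fun ε => ?_)
  have : u • x + ε • u • v = u • (x + ε • v) := by
    rw [smul_add, Units.smul_def, Units.smul_def, Units.smul_def, smul_comm]
  simp only [this, ProjSpace.pull_smul]

theorem ActsAsDirectionalDerivative.unique {P : ProjSpace F V} {ξ η : ProjTangent P} {x v : V}
    (h : ActsAsDirectionalDerivative P ξ x v) (h' : ActsAsDirectionalDerivative P η x v) :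
    ξ = η :=
  ProjTangent.ext_mfderiv fun f => (h f).unique (h' f)

/-! ### Complements of the line and spaces of linear maps -/

/-- Linear maps out of a submodule freely generated by `x` are determined by their value at `x`. -/
def evalGeneratorEquiv {N : Submodule F V} (l : V →ₗ[F] F) (x : N) (hx : l x = 1)
    (hN : ∀ n : N, l n • x = n) (W : Type*) [AddCommGroup W] [Module F W] [Module ℝ W]
    [SMulCommClass F ℝ W] : (N →ₗ[F] W) ≃ₗ[ℝ] W where
  toFun φ := φ x
  map_add' _ _ := rfl
  map_smul' _ _ := rfl
  invFun w := LinearMap.toSpanSingleton F W w ∘ₗ l ∘ₗ N.subtype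
  left_inv φ := by
    ext n
    change l n • φ x = φ n
    rw [← map_smul, hN]
  right_inv w := by
    change l x • w = w
    rw [hx, one_smul]

/-- The splitting `v = (v - l(v) x) + l(v) x` gives `V = ker l ⊕ N`; the intersection is trivial
because `n = l(n) x` on `N`. -/
theorem bijective_mkQ_kerReal {N : Submodule F V} (l : V →ₗ[F] F) (x : N) (hx : l x = 1)
    (hN : ∀ n : N, l n • x = n) :
    Function.Bijective ((N.mkQ.restrictScalars ℝ) ∘ₗ (kerReal l).subtype) := by
  constructor
  · rw [injective_iff_map_eq_zero]
    rintro ⟨k, hk⟩ h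
    have hk0 : l k = 0 := hk
    have hkN : k ∈ N := (Submodule.Quotient.mk_eq_zero N).1 h
    have := congrArg Subtype.val (hN ⟨k, hkN⟩)
    apply Subtype.ext
    simpa [hk0] using this.symm
  · intro w
    obtain ⟨v, rfl⟩ := Submodule.Quotient.mk_surjective N w
    refine ⟨kerProj l x hx v, ?_⟩
    change Submodule.Quotient.mk (v - l v • (x : V)) = _
    rw [Submodule.Quotient.eq]
    simpa using N.smul_mem (l v) x.2

/-- The quotient by the submodule generated by `x` is identified with the kernel of `l`. -/
def quotientKerEquiv {N : Submodule F V} (l : V →ₗ[F] F) (x : N) (hx : l x = 1)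
    (hN : ∀ n : N, l n • x = n) : (V ⧸ N) ≃ₗ[ℝ] kerReal l :=
  (LinearEquiv.ofBijective _ (bijective_mkQ_kerReal l x hx hN)).symm

theorem quotientKerEquiv_mk {N : Submodule F V} (l : V →ₗ[F] F) (x : N) (hx : l x = 1)
    (hN : ∀ n : N, l n • x = n) (v : V) :
    quotientKerEquiv l x hx hN (Submodule.Quotient.mk v) = kerProj l x hx v := by
  rw [quotientKerEquiv, LinearEquiv.symm_apply_eq]
  change Submodule.Quotient.mk v = Submodule.Quotient.mk (v - l v • (x : V))
  rw [Submodule.Quotient.eq]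
  simpa using N.smul_mem (l v) x.2

/-- Being self-adjoint and nonzero, `⟨p,p⟩` is a nonzero real, hence invertible. Orthogonal
projection along `p` then exists even if the form is degenerate elsewhere. -/
theorem HermitianFormOn.bijective_mkQ_perp [StarRing F] [StarModule ℝ F]
    (hself : ∀ x : F, star x = x → ∃ r : ℝ, x = algebraMap ℝ F r) (h : HermitianFormOn F V)
    {p : V} (hp : h.toFun p p ≠ 0) :
    Function.Bijective ((Submodule.span F {p}).mkQ ∘ₗ (h.perp p).subtype) := by
  obtain ⟨r, hr⟩ := hself _ (h.star_symm p p)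
  have hr0 : r ≠ 0 := by
    rintro rfl
    exact hp (by rw [hr, map_zero])
  obtain ⟨u, hu⟩ : IsUnit (h.toFun p p) := by
    rw [hr]
    exact (isUnit_iff_ne_zero.2 hr0).map (algebraMap ℝ F)
  constructor
  · rw [injective_iff_map_eq_zero]
    rintro ⟨v, hv⟩ h0
    have hvN : v ∈ Submodule.span F {p} := (Submodule.Quotient.mk_eq_zero _).1 h0
    obtain ⟨a, rfl⟩ := Submodule.mem_span_singleton.1 hvN
    have hv0 : h.toFun (a • p) p = 0 := hv
    rw [h.smul_left, ← hu, Units.mul_left_eq_zero] at hv0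
    apply Subtype.ext
    simp [hv0]
  · intro w
    obtain ⟨v, rfl⟩ := Submodule.Quotient.mk_surjective _ w
    -- Gram–Schmidt coefficient, making `v + a p` orthogonal to `p`.
    set a : F := -(h.toFun v p * ↑u⁻¹) with ha
    have hmem : v + a • p ∈ h.perp p := by
      change h.toFun (v + a • p) p = 0
      rw [h.add_left, h.smul_left, ← hu, ha, neg_mul, Units.inv_mul_cancel_right, add_neg_cancel]
    refine ⟨⟨v + a • p, hmem⟩, ?_⟩
    change Submodule.Quotient.mk (v + a • p) = _
    rw [Submodule.Quotient.eq, add_sub_cancel_left]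
    exact Submodule.smul_mem _ _ (Submodule.mem_span_singleton_self p)

/-- Postcomposition with a bijective linear map, as a real linear isomorphism. -/
def postcompEquiv {N W W' : Type*} [AddCommGroup N] [Module F N] [AddCommGroup W] [Module F W]
    [Module ℝ W] [SMulCommClass F ℝ W] [AddCommGroup W'] [Module F W'] [Module ℝ W']
    [SMulCommClass F ℝ W'] [IsScalarTower ℝ F W] [IsScalarTower ℝ F W'] (g : W →ₗ[F] W')
    (hg : Function.Bijective g) : (N →ₗ[F] W) ≃ₗ[ℝ] (N →ₗ[F] W') where
  toFun φ := g ∘ₗ φ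
  map_add' φ ψ := LinearMap.comp_add φ ψ g
  map_smul' r φ := by
    ext n
    exact (g.restrictScalars ℝ).map_smul r (φ n)
  invFun ψ := (LinearEquiv.ofBijective g hg).symm.toLinearMap ∘ₗ ψ
  left_inv φ := by
    ext n
    exact (LinearEquiv.ofBijective g hg).symm_apply_apply (φ n)
  right_inv ψ := by
    ext n
    exact (LinearEquiv.ofBijective g hg).apply_symm_apply (ψ n)

end

end

/-! ### The tangent space isomorphisms -/

theorem mainTheorem3 {F V : Type*} [Ring F] [Algebra ℝ F] [Module.Finite ℝ F]
    [NormedAddCommGroup V] [NormedSpace ℝ V] [Module F V] [IsScalarTower ℝ F V]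
    [Module.Free F V] [Module.Finite F V] (p : GoodPoints F V) :
    ∃ t : (Submodule.span F {(p : V)} →ₗ[F] V ⧸ Submodule.span F {(p : V)}) ≃ₗ[ℝ]
        ProjTangent (ProjSpace.mk p),
      (∀ (φ : Submodule.span F {(p : V)} →ₗ[F] V ⧸ Submodule.span F {(p : V)})
          (ξ : ProjTangent (ProjSpace.mk p)),
        ξ = t φ ↔
          ∀ q : Submodule.span F {(p : V)},
            (∃ hq : IsGoodPoint F (q : V), ProjSpace.mk ⟨(q : V), hq⟩ = ProjSpace.mk p) →
            ∀ v : V, Submodule.Quotient.mk v = φ q →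
              ActsAsDirectionalDerivative (ProjSpace.mk p) ξ (q : V) v) ∧
      (∀ [StarRing F] [StarModule ℝ F],
        (∀ x : F, star x = x → ∃ r : ℝ, x = algebraMap ℝ F r) →
        ∀ h : HermitianFormOn F V, h.toFun p p ≠ 0 →
          ∃ s : (Submodule.span F {(p : V)} →ₗ[F] h.perp p) ≃ₗ[ℝ] ProjTangent (ProjSpace.mk p),
            ∀ ψ : Submodule.span F {(p : V)} →ₗ[F] h.perp p,
              s ψ = t ((Submodule.span F {(p : V)}).mkQ ∘ₗ (h.perp p).subtype ∘ₗ ψ)) := by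
  obtain ⟨l, p₀, h, hc⟩ : ∃ (l : V →ₗ[F] F) (p₀ : V) (h : l p₀ = 1),
      chartAt (ProjModel F V) (ProjSpace.mk p) = affineChart l p₀ h :=
    chart_mem_atlas (ProjModel F V) (ProjSpace.mk p)
  have hsrc := mem_chart_source (ProjModel F V) (ProjSpace.mk p)
  rw [hc] at hsrc
  obtain ⟨w, hw⟩ := (ProjSpace.mk_mem_domain l p).1 hsrc
  set N := Submodule.span F {(p : V)} with hNdef
  have hpN : (p : V) ∈ N := Submodule.mem_span_singleton_self _
  -- The representative normalized for the chosen chart; it freely generates `F p`.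
  let x : N := ⟨(↑w⁻¹ : F) • (p : V), N.smul_mem _ hpN⟩
  have hx : l x = 1 := by
    change l ((↑w⁻¹ : F) • (p : V)) = 1
    rw [map_smul, ← hw, smul_eq_mul, Units.inv_mul]
  have hN : ∀ n : N, l n • x = n := by
    rintro ⟨n, hn⟩
    obtain ⟨a, rfl⟩ := Submodule.mem_span_singleton.1 hn
    apply Subtype.ext
    change l (a • (p : V)) • ((↑w⁻¹ : F) • (p : V)) = a • (p : V)
    rw [map_smul, ← hw, smul_eq_mul, smul_smul, Units.mul_inv_cancel_right]
  have hxg : IsGoodPoint F (x : V) :=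
    isGoodPoint_of_functional l (by rw [hx]; exact isUnit_one)
  have hxp : ProjSpace.mk ⟨(x : V), hxg⟩ = ProjSpace.mk p := ProjSpace.mk_eq_mk.2 ⟨w⁻¹, rfl⟩
  let t : (N →ₗ[F] V ⧸ N) ≃ₗ[ℝ] ProjTangent (ProjSpace.mk p) :=
    (evalGeneratorEquiv l x hx hN (V ⧸ N)).trans
      ((quotientKerEquiv l x hx hN).trans (kerEquiv l p₀ h).toLinearEquiv)
  have ht : ∀ φ : N →ₗ[F] V ⧸ N, ∀ v : V, Submodule.Quotient.mk v = φ x →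
      ActsAsDirectionalDerivative (ProjSpace.mk p) (t φ) x v := fun φ v hv => by
    have : t φ = kerEquiv l p₀ h (kerProj l x hx v) := by
      rw [← quotientKerEquiv_mk l x hx hN, hv]
      rfl
    rw [this]
    exact actsAsDirectionalDerivative_kerProj hc ⟨x, hxg⟩ hxp hx v
  refine ⟨t, fun φ ξ => ⟨?_, fun H => ?_⟩, ?_⟩
  · rintro rfl q ⟨hq, hqp⟩ v hv
    obtain ⟨u, hu⟩ := ProjSpace.mk_eq_mk.1 (hqp.trans hxp.symm)
    have hu' : u • (x : V) = q := hu
    have hqx : q = (u : F) • x := Subtype.ext hu'.symm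
    -- Here `q = u x`, so `u⁻¹ v` represents `φ x`; scaling the pair `(x, u⁻¹ v)` by `u` gives `(q,
    -- v)`.
    have h1 := (ht φ ((↑u⁻¹ : F) • v) (by
      rw [Submodule.Quotient.mk_smul, hv, hqx, map_smul, smul_smul, Units.inv_mul,
        one_smul])).smul u
    rwa [hu', Units.smul_def, smul_smul, Units.mul_inv, one_smul] at h1
  · obtain ⟨v, hv⟩ := Submodule.Quotient.mk_surjective N (φ x)
    -- The single representative `x` already determines `ξ`.
    exact (H x ⟨hxg, hxp⟩ v hv).unique (ht φ v hv)
  · intro _ _ hself hf hp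
    exact ⟨(postcompEquiv _ (hf.bijective_mkQ_perp hself hp)).trans t, fun ψ => rfl⟩
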